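/- **Theorem 4.8.** All rings are commutative with identity. For a finite sequence $\mathbf x=x_1,\dots,x_\ell$ of elements of a ring $A$, let $K(\mathbf x)$ denote its Koszul chain complex, with homology $H_i(\mathbf x)$, and let $H^i_{\mathbf x}(A)$ be the $i$-th cohomology of the Čech complex $\bigotimes_{k=1}^{\ell}(0\to A\to A_{x_k}\to 0)$, where $A$ is placed in degree $0$. Write $\mathbf x^n=x_1^n,\dots,x_\ell^n$. * $\mathbf x$ is *weakly proregular* if for every $n$ there is an $m\ge n$ such that the natural maps $H_i(\mathbf x^m)\to H_i(\mathbf x^n)$ are zero for all $i\ge 1$. (These maps are induced by the tensor product of the chain maps $K(x_k^m)\to K(x_k^n)$ given by multiplication by $x_k^{m-n}$ in degree $1$ and the identity in degree $0$.) * $\mathbf x$ is a *parameter sequence* on $A$ if it is weakly proregular, $(\mathbf x)A\ne A$, and $H^{\ell}_{\mathbf x}(A)_p\ne 0$ for every prime ideal $p\supseteq(\mathbf x)A$. * $\mathbf x$ is a *strong parameter sequence* on $A$ if $x_1,\dots,x_i$ is a parameter sequence on $A$ for every $i=1,\dots,\ell$. * $\mathbf x$ is a *regular sequence* on $A$ if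 $(\mathbf x)A\neq A$ and $x_i$ is a non-zero-divisor on $A/(x_1,\dots,x_{i-1})A$ for $i=1,\dots,\ell$. * $A$ is *Cohen–Macaulay* if every strong parameter sequence on $A$ is a regular sequence on $A$, and *locally Cohen–Macaulay* if $A_p$ is Cohen–Macaulay for every prime ideal $p$ of $A$. * $A$ is *coherent* if every finitely generated ideal of $A$ is finitely presented, and *regular* if every finitely generated ideal of $A$ has finite projective dimension. Let $R$ be a coherent regular ring. Then $R$ is locally Cohen–Macaulay; that is, for every prime ideal $p$ of $R$, every strong parameter sequence on $R_p$ is a regular sequence on $R_p$. -/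

import Mathlib

open CategoryTheory

universe u

namespace NonNoetherianCM

noncomputable section

variable {R : Type u} [CommRing R]

/-! ### Increasing index tuples -/

/-- The strictly increasing tuple `σ 0 < ⋯ < σ i` with its `j`-th entry omitted. -/
def face {n i : ℕ} (σ : Fin (i + 1) ↪o Fin n) (j : Fin (i + 1)) : Fin i ↪o Fin n :=
  (Fin.succAboveOrderEmb j).trans σ

lemma face_face {n i : ℕ} (σ : Fin (i + 2) ↪o Fin n) (j : Fin (i + 2)) (k : Fin (i + 1)) :
    face (face σ (j.succAbove k)) (k.predAbove j) = face (face σ j) k := by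
  ext a
  simp [face, Fin.succAbove_succAbove_succAbove_predAbove]

/-- A double alternating sum vanishes if its terms are invariant under exchanging the order in
which two entries are omitted. -/
lemma alternating_sum_eq_zero {M : Type*} [AddCommGroup M] [Module R M] (i : ℕ)
    (g : Fin (i + 2) → Fin (i + 1) → M)
    (hg : ∀ j k, g (j.succAbove k) (k.predAbove j) = g j k) :
    ∑ j : Fin (i + 2), ∑ k : Fin (i + 1), (-1 : R) ^ ((j : ℕ) + (k : ℕ)) • g j k = 0 := by
  rw [← Fintype.sum_prod_type' (f := fun (j : Fin (i + 2)) (k : Fin (i + 1)) =>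
    (-1 : R) ^ ((j : ℕ) + (k : ℕ)) • g j k)]
  refine Finset.sum_involution (fun p _ => (p.1.succAbove p.2, p.2.predAbove p.1)) ?_ ?_ ?_ ?_
  · rintro ⟨j, k⟩ -
    simp [Fin.neg_one_pow_succAbove_add_predAbove, hg]
  · rintro ⟨j, k⟩ - - h
    exact Fin.succAbove_ne j k (congrArg Prod.fst h)
  · simp
  · rintro ⟨j, k⟩ -
    simp [Fin.succAbove_succAbove_predAbove, Fin.predAbove_predAbove_succAbove]

/-! ### The Koszul complex -/

/-- The differential of the Koszul complex `K(x) = K(x₁) ⊗ ⋯ ⊗ K(xₙ)`. Its module in degree `i` is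
free on the basis elements `e_σ`, one for each increasing `i`-tuple `σ` of indices, and
`d e_σ = ∑ j, (-1)^j x_{σ j} e_{σ without its j-th entry}`. -/
def koszulD {n : ℕ} (x : Fin n → R) (i : ℕ) :
    ((Fin (i + 1) ↪o Fin n) →₀ R) →ₗ[R] ((Fin i ↪o Fin n) →₀ R) :=
  Finsupp.linearCombination R fun σ =>
    ∑ j : Fin (i + 1), Finsupp.single (face σ j) ((-1 : R) ^ (j : ℕ) * x (σ j))

lemma koszulD_comp {n : ℕ} (x : Fin n → R) (i : ℕ) :
    koszulD x i ∘ₗ koszulD x (i + 1) = 0 := by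
  refine Finsupp.lhom_ext' fun σ => LinearMap.ext_ring ?_
  have h := alternating_sum_eq_zero (R := R) i
    (fun j k => Finsupp.single (face (face σ j) k) (x (σ j) * x (face σ j k))) (by
      intro j k
      have h1 : face σ (j.succAbove k) (k.predAbove j) = σ j := by
        simp [face, Fin.succAbove_succAbove_predAbove]
      have h2 : face σ j k = σ (j.succAbove k) := rfl
      rw [face_face, h1, h2, mul_comm])
  simpa [koszulD, Finset.smul_sum, pow_add, mul_assoc, mul_left_comm, -Finsupp.single_mul] using h

/-- The Koszul chain complex `K(x)` of a finite sequence `x` of elements of `R`. -/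
def koszulComplex {n : ℕ} (x : Fin n → R) : ChainComplex (ModuleCat.{u} R) ℕ :=
  ChainComplex.of (fun i => ModuleCat.of R ((Fin i ↪o Fin n) →₀ R))
    (fun i => ModuleCat.ofHom (koszulD x i))
    (fun i => by rw [← ModuleCat.ofHom_comp, koszulD_comp, ModuleCat.ofHom_zero])

/-- The map `e_σ ↦ (∏ j, x_{σ j} ^ (b - a)) e_σ` on the modules of degree `i`. -/
def koszulTransitionMap {n : ℕ} (x : Fin n → R) (a b i : ℕ) :
    ((Fin i ↪o Fin n) →₀ R) →ₗ[R] ((Fin i ↪o Fin n) →₀ R) :=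
  Finsupp.linearCombination R fun σ => Finsupp.single σ (∏ j, x (σ j) ^ (b - a))

lemma koszulTransitionMap_comm {n : ℕ} (x : Fin n → R) {a b : ℕ} (h : a ≤ b) (i : ℕ) :
    koszulD (fun k => x k ^ a) i ∘ₗ koszulTransitionMap x a b (i + 1) =
      koszulTransitionMap x a b i ∘ₗ koszulD (fun k => x k ^ b) i := by
  refine Finsupp.lhom_ext' fun σ => LinearMap.ext_ring ?_
  have key : ∀ j : Fin (i + 1), (∏ k, x (σ k) ^ (b - a)) * x (σ j) ^ a =
      x (σ j) ^ b * ∏ k, x (face σ j k) ^ (b - a) := by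
    intro j
    rw [Fin.prod_univ_succAbove _ j]
    have : x (σ j) ^ b = x (σ j) ^ (b - a) * x (σ j) ^ a := by
      rw [← pow_add, Nat.sub_add_cancel h]
    rw [this]
    simp only [face, RelEmbedding.coe_trans, Function.comp, Fin.succAboveOrderEmb_apply]
    ring
  have key2 : ∀ j : Fin (i + 1),
      (∏ k, x (σ k) ^ (b - a)) * ((-1) ^ (j : ℕ) * x (σ j) ^ a) =
        (-1) ^ (j : ℕ) * x (σ j) ^ b * ∏ k, x (face σ j k) ^ (b - a) := by
    intro j
    rw [mul_left_comm, key, mul_assoc]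
  simp [koszulD, koszulTransitionMap, Finset.smul_sum, -Finsupp.single_mul, key2]

/-- The chain map `φ : K(x ^ b) ⟶ K(x ^ a)` for `a ≤ b`, the tensor product of the chain maps
`K(x_k ^ b) ⟶ K(x_k ^ a)` given by `x_k ^ (b - a)` in degree one and the identity in degree
zero. -/
def koszulTransition {n : ℕ} (x : Fin n → R) {a b : ℕ} (h : a ≤ b) :
    koszulComplex (fun k => x k ^ b) ⟶ koszulComplex (fun k => x k ^ a) :=
  ChainComplex.ofHom (fun i => ModuleCat.ofHom (koszulTransitionMap x a b i)) (by
    intro i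
    simp only [koszulComplex, ChainComplex.of_d]
    rw [← ModuleCat.ofHom_comp, ← ModuleCat.ofHom_comp, koszulTransitionMap_comm x h])

/-- The sequence `x` is weakly proregular: for each `a` there is `b ≥ a` such that the maps
`H_i(x ^ b) → H_i(x ^ a)` on Koszul homology are zero for all `i ≥ 1`. -/
def IsWeaklyProregular {n : ℕ} (x : Fin n → R) : Prop :=
  ∀ a : ℕ, ∃ (b : ℕ) (h : a ≤ b), ∀ i : ℕ, 1 ≤ i →
    HomologicalComplex.homologyMap (koszulTransition x h) i = 0

/-! ### The Čech complex -/

/-- The natural `R`-algebra map `R_a → R_b` when `a` divides `b`. -/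
def awayRestrict {a b : R} (h : a ∣ b) : Localization.Away a →ₐ[R] Localization.Away b :=
  IsLocalization.Away.liftAlgHom (f := Algebra.ofId R (Localization.Away b)) a
    (isUnit_of_dvd_unit ((algebraMap R (Localization.Away b)).map_dvd h)
      (IsLocalization.Away.algebraMap_isUnit b))

lemma awayRestrict_awayRestrict {a b c : R} (h : a ∣ b) (h' : b ∣ c) (r : Localization.Away a) :
    awayRestrict h' (awayRestrict h r) = awayRestrict (h.trans h') r := by
  have : (awayRestrict h').comp (awayRestrict h) = awayRestrict (h.trans h') :=
    (IsLocalization.algHom_subsingleton (Submonoid.powers a)).elim _ _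
  exact DFunLike.congr_fun this r

/-- The product `x_{σ 0} ⋯ x_{σ (i - 1)}`. -/
def tupleProd {n : ℕ} (x : Fin n → R) {i : ℕ} (σ : Fin i ↪o Fin n) : R := ∏ j, x (σ j)

lemma tupleProd_face_dvd {n : ℕ} (x : Fin n → R) {i : ℕ} (σ : Fin (i + 1) ↪o Fin n)
    (j : Fin (i + 1)) : tupleProd x (face σ j) ∣ tupleProd x σ := by
  rw [tupleProd, tupleProd, Fin.prod_univ_succAbove _ j]
  exact dvd_mul_left _ _

/-- The module of degree `i` in the Čech complex: the product, over all increasing `i`-tuples `σ`,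
of the localizations of `R` at `x_{σ 0} ⋯ x_{σ (i - 1)}`. -/
abbrev CechModule {n : ℕ} (x : Fin n → R) (i : ℕ) : Type u :=
  ∀ σ : Fin i ↪o Fin n, Localization.Away (tupleProd x σ)

/-- The Čech differential: the alternating sum of the natural localization maps. -/
def cechD {n : ℕ} (x : Fin n → R) (i : ℕ) : CechModule x i →ₗ[R] CechModule x (i + 1) :=
  LinearMap.pi fun σ => ∑ j : Fin (i + 1), (-1 : R) ^ (j : ℕ) •
    ((awayRestrict (tupleProd_face_dvd x σ j)).toLinearMap ∘ₗ LinearMap.proj (face σ j))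

lemma cechD_comp {n : ℕ} (x : Fin n → R) (i : ℕ) : cechD x (i + 1) ∘ₗ cechD x i = 0 := by
  refine LinearMap.ext fun f => funext fun σ => ?_
  have hdvd : ∀ j k, tupleProd x (face (face σ j) k) ∣ tupleProd x σ := fun j k =>
    (tupleProd_face_dvd x (face σ j) k).trans (tupleProd_face_dvd x σ j)
  have aux : ∀ (τ τ' : Fin i ↪o Fin n) (h : tupleProd x τ ∣ tupleProd x σ)
      (h' : tupleProd x τ' ∣ tupleProd x σ), τ = τ' →
      awayRestrict h (f τ) = awayRestrict h' (f τ') := by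
    rintro τ _ h h' rfl
    rfl
  have key := alternating_sum_eq_zero (R := R) i
    (fun j k => awayRestrict (hdvd j k) (f (face (face σ j) k)))
    (fun j k => aux _ _ _ _ (face_face σ j k))
  simpa [cechD, Finset.smul_sum, pow_add, mul_smul, awayRestrict_awayRestrict] using key

/-- The Čech cochain complex `C(x) = C(x₁) ⊗ ⋯ ⊗ C(xₙ)` of a finite sequence `x`, where `C(a)` is
`0 → R → R_a → 0` with `R` in degree zero. -/
def cechComplex {n : ℕ} (x : Fin n → R) : CochainComplex (ModuleCat.{u} R) ℕ :=
  CochainComplex.of (fun i => ModuleCat.of R (CechModule x i))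
    (fun i => ModuleCat.ofHom (cechD x i))
    (fun i => by rw [← ModuleCat.ofHom_comp, cechD_comp, ModuleCat.ofHom_zero])

/-- The Čech cohomology module `H^i_x(R)`. -/
abbrev cechCohomology {n : ℕ} (x : Fin n → R) (i : ℕ) : ModuleCat.{u} R :=
  (cechComplex x).homology i

/-! ### Parameter sequences and the Cohen–Macaulay property -/

/-- Parameter sequences: `x` is weakly proregular, generates a proper ideal, and its top Čech
cohomology is nonzero at every prime containing it. -/
structure IsParameterSequence {n : ℕ} (x : Fin n → R) : Prop where
  weaklyProregular : IsWeaklyProregular x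
  span_ne_top : Ideal.span (Set.range x) ≠ ⊤
  nontrivial_localization : ∀ p : Ideal R, ∀ _ : p.IsPrime, Ideal.span (Set.range x) ≤ p →
    Nontrivial (LocalizedModule p.primeCompl (cechCohomology x n))

/-- Strong parameter sequences: every nonempty initial segment is a parameter sequence. -/
def IsStrongParameterSequence {n : ℕ} (x : Fin n → R) : Prop :=
  ∀ i : ℕ, 1 ≤ i → ∀ h : i ≤ n, IsParameterSequence fun k : Fin i => x (Fin.castLE h k)

variable (R)

/-- A ring is Cohen–Macaulay if every strong parameter sequence is a regular sequence. -/
def IsCohenMacaulay : Prop :=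
  ∀ (n : ℕ) (x : Fin n → R), IsStrongParameterSequence x →
    RingTheory.Sequence.IsRegular R (List.ofFn x)

/-- A ring is locally Cohen–Macaulay if its localization at every prime is Cohen–Macaulay. -/
def IsLocallyCohenMacaulay : Prop :=
  ∀ p : Ideal R, ∀ _ : p.IsPrime, IsCohenMacaulay (Localization.AtPrime p)

/-- A ring is coherent if every finitely generated ideal is finitely presented. -/
def IsCoherent : Prop :=
  ∀ I : Ideal R, I.FG → Module.FinitePresentation R I

/-- A (not necessarily Noetherian) ring is regular if every finitely generated ideal has finite
projective dimension. -/
def IsRegular : Prop :=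
  ∀ I : Ideal R, I.FG → ∃ d : ℕ, HasProjectiveDimensionLE (ModuleCat.of.{u} R I) d

end

end NonNoetherianCM

/-! Let `A = R_p`, and let `x` be a strong parameter sequence on `A`. Coherence and regularity of
`R` give every quotient of `A` by a finitely generated ideal a finite free resolution. Regularity of
`x` is proved by induction along the sequence. Suppose `x₁, …, x_r` is weakly regular, `I` is the
ideal it generates, and `x_{r+1} b ∈ I` with `b ∉ I`. Let `q` be a minimal prime over `(I : b)`,
which contains all `x_k`, and put `C = A_q`. Two facts contradict each other.

Small projective dimension: `C / IC` has depth zero in the sense of `DepthZero`, so the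
Auslander-Buchsbaum argument `HasFiniteFreeResolution.hasProjectiveDimensionLE` bounds the
projective dimension of each `C / (x₁^a, …, x_{r+1}^a)` by `r`.

Large projective dimension: by weak proregularity the Koszul complexes of the powers of `x` behave,
as an inverse system, like resolutions of these quotients. If all of them have projective dimension
at most `r`, dimension shifting (`CyclesToBoundaries.exists_extension`) makes the top transition map
factor through the last differential after some transition, so that `(∏ x_k)^(b - a) ∈ (x_k^b)` for
some `b`. This kills the top Čech cohomology at `q` (`exists_smul_mem_range_cechD`), which a
parameter sequence forbids. -/

namespace NonNoetherianCM

open RingTheory.Sequence IsLocalRing TensorProduct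

/-! ### Finite free resolutions -/

/-- Modules with a finite resolution by finite free modules, up to a finite projective module at
the end of the resolution. -/
inductive HasFiniteFreeResolution (R : Type u) [CommRing R] :
    ∀ (M : Type u) [AddCommGroup M] [Module R M], Prop
  | of_projective (M : Type u) [AddCommGroup M] [Module R M] [Module.Finite R M]
      [Module.Projective R M] : HasFiniteFreeResolution R M
  | of_exact (N F M : Type u) [AddCommGroup N] [Module R N] [AddCommGroup F] [Module R F]
      [AddCommGroup M] [Module R M] [Module.Finite R F] [Module.Free R F]
      (f : N →ₗ[R] F) (g : F →ₗ[R] M) (hf : Function.Injective f) (hfg : Function.Exact f g)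
      (hg : Function.Surjective g) (hN : HasFiniteFreeResolution R N) :
      HasFiniteFreeResolution R M

lemma HasFiniteFreeResolution.of_equiv {R : Type u} [CommRing R] {M M' : Type u}
    [AddCommGroup M] [Module R M] [AddCommGroup M'] [Module R M']
    (h : HasFiniteFreeResolution R M) (e : M ≃ₗ[R] M') : HasFiniteFreeResolution R M' := by
  cases h with
  | of_projective =>
    have := Module.Finite.equiv e
    have := Module.Projective.of_equiv e
    exact .of_projective _
  | of_exact N F _ f g hf hfg hg hN =>
    refine .of_exact N F M' f (e.toLinearMap ∘ₗ g) hf ?_ (e.surjective.comp hg) hN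
    intro y
    simpa using hfg y

/-- Finite free resolutions are preserved by flat base change. -/
lemma HasFiniteFreeResolution.baseChange {R : Type u} [CommRing R] (S : Type u) [CommRing S]
    [Algebra R S] [Module.Flat R S] {M : Type u} [AddCommGroup M] [Module R M]
    (h : HasFiniteFreeResolution R M) : HasFiniteFreeResolution S (S ⊗[R] M) := by
  induction h with
  | of_projective M => exact .of_projective _
  | of_exact N F M f g hf hfg hg hN ih =>
    refine .of_exact (S ⊗[R] N) (S ⊗[R] F) (S ⊗[R] M) (f.baseChange S) (g.baseChange S)
      ?_ ?_ ?_ ih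
    · exact Module.Flat.lTensor_preserves_injective_linearMap f hf
    · exact lTensor_exact S hfg hg
    · exact LinearMap.lTensor_surjective S hg

lemma hasFiniteFreeResolution_quotient_map {R : Type u} [CommRing R] (S : Type u) [CommRing S]
    [Algebra R S] [Module.Flat R S] {I : Ideal R} (h : HasFiniteFreeResolution R (R ⧸ I)) :
    HasFiniteFreeResolution S (S ⧸ I.map (algebraMap R S)) :=
  (h.baseChange S).of_equiv (Ideal.qoutMapEquivTensorQout S).symm

/-- Finite submodules of finite free modules over a coherent ring are finitely presented. -/
lemma IsCoherent.finitePresentation {R : Type u} [CommRing R] (hR : IsCoherent R) {n : ℕ}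
    {M : Type*} [AddCommGroup M] [Module R M] [Module.Finite R M] (f : M →ₗ[R] Fin n → R)
    (hf : Function.Injective f) : Module.FinitePresentation R M := by
  induction n generalizing M with
  | zero =>
    have : Subsingleton M := hf.subsingleton
    exact Module.finitePresentation_of_projective R M
  | succ n ih =>
    -- The first coordinate has a finitely generated ideal as image, finitely presented by
    -- coherence; its kernel is then finite and embeds in one coordinate fewer.
    let l : M →ₗ[R] R := LinearMap.proj 0 ∘ₗ f
    have := hR (LinearMap.range l) ((LinearMap.range_eq_map l) ▸ Module.Finite.fg_top.map l)
    have hl := l.surjective_rangeRestrict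
    have : Module.Finite R (LinearMap.ker l.rangeRestrict) :=
      .of_fg (Module.FinitePresentation.fg_ker _ hl)
    have := ih (M := LinearMap.ker l.rangeRestrict)
      (LinearMap.funLeft R R Fin.succ ∘ₗ f ∘ₗ Submodule.subtype _) (by
        rw [injective_iff_map_eq_zero]
        rintro ⟨x, hx⟩ h
        rw [LinearMap.ker_rangeRestrict, LinearMap.mem_ker] at hx
        rw [Submodule.mk_eq_zero, ← hf.eq_iff' (map_zero f)]
        funext i
        exact Fin.cases hx (fun j => congrFun h j) i)
    exact Module.finitePresentation_of_ker l.rangeRestrict hl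

/-- Coherence keeps each syzygy finitely presented, and each syzygy lowers the bound on the
projective dimension by one. -/
lemma IsCoherent.hasFiniteFreeResolution {R : Type u} [CommRing R] (hR : IsCoherent R) (d : ℕ)
    (M : Type u) [AddCommGroup M] [Module R M] [Module.FinitePresentation R M]
    (hM : HasProjectiveDimensionLE (ModuleCat.of R M) d) : HasFiniteFreeResolution R M := by
  induction d generalizing M with
  | zero =>
    have : Module.Projective R M :=
      (IsProjective.iff_projective M).2 (projective_iff_hasProjectiveDimensionLE_zero _ |>.2 hM)
    exact .of_projective M
  | succ d ih =>
    obtain ⟨n, g, hg⟩ := Module.Finite.exists_fin' R M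
    have : Module.Finite R (LinearMap.ker g) := .of_fg (Module.FinitePresentation.fg_ker g hg)
    have := hR.finitePresentation (LinearMap.ker g).subtype Subtype.val_injective
    have hS := LinearMap.shortExact_shortComplexKer hg
    have : Projective (ModuleCat.of R (Fin n → R)) :=
      ModuleCat.projective_of_categoryTheory_projective _
    have := hS.hasProjectiveDimensionLT_X₁ (d + 1) (hasProjectiveDimensionLT_of_ge _ 1 _ (by simp)) hM
    exact .of_exact _ _ _ _ g Subtype.val_injective g.exact_subtype_ker_map hg (ih _ this)

lemma IsRegular.hasFiniteFreeResolution_quotient {R : Type u} [CommRing R] (hR : IsRegular R)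
    (hcoh : IsCoherent R) {I : Ideal R} (hI : I.FG) : HasFiniteFreeResolution R (R ⧸ I) := by
  obtain ⟨d, hd⟩ := hR I hI
  have := hcoh I hI
  exact .of_exact I R (R ⧸ I) I.subtype I.mkQ Subtype.val_injective
    (LinearMap.exact_subtype_mkQ I) I.mkQ_surjective (hcoh.hasFiniteFreeResolution d I hd)

/-! ### Weakly regular sequences and exact sequences -/

section Syzygy

variable {R : Type*} [CommRing R] {N F M : Type*} [AddCommGroup N] [Module R N]
  [AddCommGroup F] [Module R F] [AddCommGroup M] [Module R M]

/-- If `0 → N → F → M → 0` is exact and `rs` is weakly regular on `M`, then `N / rs N → F / rs F` is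
injective. -/
lemma mem_smul_top_of_isWeaklyRegular {rs : List R} (h : IsWeaklyRegular M rs) {f : N →ₗ[R] F}
    {g : F →ₗ[R] M} (hf : Function.Injective f) (hfg : Function.Exact f g)
    (hg : Function.Surjective g) {v : N}
    (hv : f v ∈ (Ideal.ofList rs • ⊤ : Submodule R F)) :
    v ∈ (Ideal.ofList rs • ⊤ : Submodule R N) := by
  have h0 : Function.Exact (0 : PUnit.{1} →ₗ[R] N) f := fun y => by
    simp [hf.eq_iff' (map_zero f), eq_comm]
  have := map_first_exact_on_four_term_right_exact_of_isSMulRegular_last h0 hfg hg h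
  have h1 := (this (Submodule.Quotient.mk v)).1 (by
    rw [Submodule.mapQ_apply, Submodule.Quotient.mk_eq_zero]; exact hv)
  obtain ⟨w, hw⟩ := h1
  obtain ⟨w, rfl⟩ := Submodule.Quotient.mk_surjective _ w
  rw [Submodule.mapQ_apply, LinearMap.zero_apply] at hw
  exact (Submodule.Quotient.mk_eq_zero _).1 (hw.symm.trans (Submodule.Quotient.mk_zero _))

end Syzygy

/-- Passing to a syzygy increases by one the length of the initial segments of a weakly regular
sequence which remain weakly regular. -/
lemma isWeaklyRegular_append_singleton_of_exact {R : Type*} [CommRing R] {rs : List R} {t : R}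
    {N F M : Type*} [AddCommGroup N] [Module R N]
    [AddCommGroup F] [Module R F] [AddCommGroup M] [Module R M] (h : IsWeaklyRegular M rs)
    (hF : IsWeaklyRegular F (rs ++ [t])) {f : N →ₗ[R] F}
    {g : F →ₗ[R] M} (hf : Function.Injective f) (hfg : Function.Exact f g)
    (hg : Function.Surjective g) : IsWeaklyRegular N (rs ++ [t]) := by
  induction rs generalizing N F M with
  | nil =>
    simp only [List.nil_append, isWeaklyRegular_singleton_iff] at hF ⊢
    exact hF.of_injective f hf
  | cons r rs ih =>
    rw [List.cons_append, isWeaklyRegular_cons_iff] at hF ⊢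
    rw [isWeaklyRegular_cons_iff] at h
    refine ⟨hF.1.of_injective f hf, ih h.2 hF.2 (f := QuotSMulTop.map r f)
      (g := QuotSMulTop.map r g) ?_ (QuotSMulTop.map_exact r hfg hg)
      (QuotSMulTop.map_surjective r hg)⟩
    have h0 : Function.Exact (0 : PUnit.{1} →ₗ[R] N) f := fun y => by
      simp [hf.eq_iff' (map_zero f), eq_comm]
    have := QuotSMulTop.map_first_exact_on_four_term_exact_of_isSMulRegular_last h0 hfg h.1
    rw [injective_iff_map_eq_zero]
    intro v hv
    obtain ⟨w, rfl⟩ := (this v).1 hv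
    simp

lemma isWeaklyRegular_of_exact {R : Type*} [CommRing R] {rs : List R}
    {N F M : Type*} [AddCommGroup N] [Module R N]
    [AddCommGroup F] [Module R F] [AddCommGroup M] [Module R M] (h : IsWeaklyRegular M rs)
    (hF : IsWeaklyRegular F rs) {f : N →ₗ[R] F}
    {g : F →ₗ[R] M} (hf : Function.Injective f) (hfg : Function.Exact f g)
    (hg : Function.Surjective g) : IsWeaklyRegular N rs := by
  rcases List.eq_nil_or_concat rs with rfl | ⟨rs, t, rfl⟩
  · exact .nil R N
  · rw [List.concat_eq_append] at h hF ⊢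
    exact isWeaklyRegular_append_singleton_of_exact ((isWeaklyRegular_append_iff M _ _).1 h).1
      hF hf hfg hg

/-! ### The Auslander-Buchsbaum inequality -/

/-- The condition that the quotient by the ideal `I` has depth zero: every finitely generated ideal
contained in the maximal ideal annihilates a nonzero element of the quotient. -/
def DepthZero {C : Type*} [CommRing C] [IsLocalRing C] (I : Ideal C) : Prop :=
  ∀ J : Ideal C, J.FG → J ≤ maximalIdeal C → ∃ b ∉ I, ∀ a ∈ J, b * a ∈ I

section AuslanderBuchsbaum

variable {C : Type u} [CommRing C] [IsLocalRing C] {rs : List C}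

/-- Freeness follows once `N → F` stays injective over the residue field. Depth zero forces this,
because `N / IN → F / IF` is injective for `I` generated by `rs`. -/
lemma free_of_exact (hd : DepthZero (Ideal.ofList rs)) {N F M : Type*} [AddCommGroup N] [Module C N]
    [AddCommGroup F] [Module C F] [AddCommGroup M] [Module C M] [Module.Finite C F]
    [Module.Free C F] [Module.Finite C N] [Module.Free C N] (h : IsWeaklyRegular M rs)
    {f : N →ₗ[C] F} {g : F →ₗ[C] M} (hf : Function.Injective f) (hfg : Function.Exact f g)
    (hg : Function.Surjective g) : Module.Free C M := by
  refine Module.free_of_lTensor_residueField_injective f g hg hfg ?_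
  rw [injective_iff_map_eq_zero]
  intro z hz
  obtain ⟨v, rfl⟩ := TensorProduct.mk_surjective C N (ResidueField C) residue_surjective z
  rw [TensorProduct.mk_apply, LinearMap.lTensor_tmul] at hz
  let e := Module.Free.chooseBasis C F
  let c := Module.Free.chooseBasis C N
  have hmem : ∀ i, e.repr (f v) i ∈ maximalIdeal C := by
    intro i
    have h1 := congrArg (TensorProduct.rid C (ResidueField C) ∘
      LinearMap.lTensor (ResidueField C) (e.coord i)) hz
    simp only [Function.comp_apply, LinearMap.lTensor_tmul, map_zero, TensorProduct.rid_tmul,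
      Module.Basis.coord_apply, Algebra.smul_def, mul_one] at h1
    exact (residue_eq_zero_iff _).1 h1
  have hv : ∀ i, c.repr v i ∈ maximalIdeal C := by
    intro i
    by_contra hi
    rw [mem_maximalIdeal, mem_nonunits_iff, not_not] at hi
    -- Here `v` has a unit coordinate, while the coordinates of `f v` generate a finitely generated
    -- ideal in the maximal ideal. An element `b` outside `I` that multiplies this ideal into `I`
    -- gives `f (b • v) ∈ IF`, hence `b • v ∈ IN`, and the unit coordinate yields `b ∈ I`.
    obtain ⟨b, hb, hbJ⟩ := hd (Ideal.span (Set.range (e.repr (f v))))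
      (Submodule.fg_span (Set.finite_range _)) (Ideal.span_le.2 (by rintro _ ⟨j, rfl⟩; exact hmem j))
    have h1 : f (b • v) ∈ (Ideal.ofList rs • ⊤ : Submodule C F) := by
      rw [map_smul, ← e.sum_repr (f v), Finset.smul_sum]
      refine Submodule.sum_mem _ fun j _ => ?_
      rw [smul_smul]
      exact Submodule.smul_mem_smul (hbJ _ (Ideal.subset_span ⟨j, rfl⟩)) trivial
    have h2 := mem_smul_top_of_isWeaklyRegular h hf hfg hg h1
    have h3 := Submodule.smul_top_le_comap_smul_top (Ideal.ofList rs) (c.coord i) h2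
    rw [Submodule.mem_comap, smul_eq_mul, Ideal.mul_top] at h3
    simp only [map_smul, Module.Basis.coord_apply, smul_eq_mul] at h3
    exact hb ((Ideal.mul_unit_mem_iff_mem _ hi).1 h3)
  rw [TensorProduct.mk_apply, ← c.sum_repr v, TensorProduct.tmul_sum]
  refine Finset.sum_eq_zero fun i _ => ?_
  rw [← TensorProduct.smul_tmul, Algebra.smul_def, mul_one,
    show algebraMap C (ResidueField C) (c.repr v i) = 0 from (residue_eq_zero_iff _).2 (hv i),
    TensorProduct.zero_tmul]

/-- Weak regularity passes to the syzygies, and freeness then climbs back from the end of the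
resolution. -/
lemma HasFiniteFreeResolution.free (hd : DepthZero (Ideal.ofList rs)) (hC : IsWeaklyRegular C rs)
    {M : Type u} [AddCommGroup M] [Module C M] (hM : HasFiniteFreeResolution C M)
    (h : IsWeaklyRegular M rs) : Module.Finite C M ∧ Module.Free C M := by
  induction hM with
  | of_projective M => exact ⟨inferInstance, Module.free_of_flat_of_isLocalRing⟩
  | of_exact N F M f g hf hfg hg hN ih =>
    have hF : IsWeaklyRegular F rs := (TensorProduct.rid C F).isWeaklyRegular_congr rs |>.1
      hC.isWeaklyRegular_lTensor
    obtain ⟨_, _⟩ := ih (isWeaklyRegular_of_exact h hF hf hfg hg)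
    exact ⟨Module.Finite.of_surjective g hg, free_of_exact hd h hf hfg hg⟩

/-- A module with a finite free resolution on which an initial segment of `rs` is weakly regular has
projective dimension at most the length of the remaining part of `rs`. -/
lemma HasFiniteFreeResolution.hasProjectiveDimensionLE_of_append (rs₂ : List C) {rs₁ : List C}
    (hd : DepthZero (Ideal.ofList (rs₁ ++ rs₂))) (hC : IsWeaklyRegular C (rs₁ ++ rs₂))
    {M : Type u} [AddCommGroup M] [Module C M] (hM : HasFiniteFreeResolution C M)
    (h : IsWeaklyRegular M rs₁) :
    HasProjectiveDimensionLE (ModuleCat.of C M) rs₂.length := by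
  induction rs₂ generalizing rs₁ M with
  | nil =>
    rw [List.append_nil] at hd hC
    obtain ⟨_, _⟩ := hM.free hd hC h
    exact projective_iff_hasProjectiveDimensionLE_zero _ |>.1
      ((ModuleCat.of C M).projective_of_categoryTheory_projective)
  | cons t rs₂ ih =>
    cases hM with
    | of_projective =>
      have := projective_iff_hasProjectiveDimensionLE_zero _ |>.1
        ((ModuleCat.of C M).projective_of_categoryTheory_projective)
      exact hasProjectiveDimensionLT_of_ge _ 1 _ (by simp)
    | of_exact N F _ f g hf hfg hg hN =>
      -- The syzygy `N` is weakly regular for one more element, so `t` moves to the first segment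
      -- and the bound for `N` is one less than for `M`.
      have e : rs₁ ++ t :: rs₂ = (rs₁ ++ [t]) ++ rs₂ := by simp
      rw [e] at hd hC
      have hF : IsWeaklyRegular F (rs₁ ++ [t]) :=
        (TensorProduct.rid C F).isWeaklyRegular_congr _ |>.1
          (((isWeaklyRegular_append_iff C _ _).1 hC).1.isWeaklyRegular_lTensor)
      have hN' := ih hd hC hN (isWeaklyRegular_append_singleton_of_exact h hF hf hfg hg)
      have hS := ModuleCat.shortComplex_shortExact
        (ModuleCat.shortComplexOfCompEqZero f g hfg.linearMap_comp_eq_zero) hfg hf hg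
      have : Projective (ModuleCat.of C F) := ModuleCat.projective_of_categoryTheory_projective _
      exact hS.hasProjectiveDimensionLT_X₃ _ hN' (hasProjectiveDimensionLT_of_ge _ 1 _ (by simp))

/-- A form of the Auslander-Buchsbaum inequality without Noetherian hypotheses. -/
theorem HasFiniteFreeResolution.hasProjectiveDimensionLE
    (hd : DepthZero (Ideal.ofList rs)) (hC : IsWeaklyRegular C rs)
    {M : Type u} [AddCommGroup M] [Module C M] (hM : HasFiniteFreeResolution C M) :
    HasProjectiveDimensionLE (ModuleCat.of C M) rs.length :=
  hM.hasProjectiveDimensionLE_of_append rs (rs₁ := []) hd hC (.nil C M)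

end AuslanderBuchsbaum
end NonNoetherianCM

namespace NonNoetherianCM
open Abelian

noncomputable section

/-! ### Weakly proregular sequences and projective dimension -/

section Koszul

variable {C : Type u} [CommRing C] {n : ℕ} (x : Fin n → C)

lemma koszulTransitionMap_single (a b i : ℕ) (σ : Fin i ↪o Fin n) (r : C) :
    koszulTransitionMap x a b i (Finsupp.single σ r) =
      Finsupp.single σ (r * ∏ j, x (σ j) ^ (b - a)) := by
  simp [koszulTransitionMap, -Finsupp.single_mul]

lemma koszulTransitionMap_trans {a b c : ℕ} (h : a ≤ b) (h' : b ≤ c) (i : ℕ)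
    (z : (Fin i ↪o Fin n) →₀ C) :
    koszulTransitionMap x a b i (koszulTransitionMap x b c i z) = koszulTransitionMap x a c i z := by
  induction z using Finsupp.induction_linear with
  | zero => simp
  | add f g hf hg => simp [hf, hg]
  | single σ r =>
    simp only [koszulTransitionMap_single, mul_assoc, ← Finset.prod_mul_distrib, ← pow_add]
    rw [show c - b + (b - a) = c - a by omega]

lemma koszulD_koszulTransitionMap {a b : ℕ} (h : a ≤ b) (i : ℕ)
    (z : (Fin (i + 1) ↪o Fin n) →₀ C) :
    koszulD (fun k => x k ^ a) i (koszulTransitionMap x a b (i + 1) z) =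
      koszulTransitionMap x a b i (koszulD (fun k => x k ^ b) i z) :=
  LinearMap.congr_fun (koszulTransitionMap_comm x h i) z

lemma koszulD_koszulD (i : ℕ) (z : (Fin (i + 2) ↪o Fin n) →₀ C) :
    koszulD x i (koszulD x (i + 1) z) = 0 :=
  LinearMap.congr_fun (koszulD_comp x i) z

/-- Weak proregularity in terms of elements: for each `a` there is `b ≥ a` such that the transition
maps carry Koszul cycles of positive degree for `x ^ b` to Koszul boundaries for `x ^ a`. -/
def CyclesToBoundaries : Prop :=
  ∀ a : ℕ, ∃ b, a ≤ b ∧ ∀ (i : ℕ) (z : (Fin (i + 1) ↪o Fin n) →₀ C),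
    koszulD (fun k => x k ^ b) i z = 0 →
      koszulTransitionMap x a b (i + 1) z ∈ LinearMap.range (koszulD (fun k => x k ^ a) (i + 1))

/-- The cycles of the Koszul complex of `x ^ a` augmented to its homology in degree zero. -/
def koszulCycles (a : ℕ) : ∀ i : ℕ, Submodule C ((Fin i ↪o Fin n) →₀ C)
  | 0 => LinearMap.range (koszulD (fun k => x k ^ a) 0)
  | i + 1 => LinearMap.ker (koszulD (fun k => x k ^ a) i)

lemma koszulD_mem_koszulCycles (a i : ℕ) (z : (Fin (i + 1) ↪o Fin n) →₀ C) :
    koszulD (fun k => x k ^ a) i z ∈ koszulCycles x a i := by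
  cases i with
  | zero => exact ⟨z, rfl⟩
  | succ i => exact koszulD_koszulD _ i z

lemma koszulTransitionMap_mem_koszulCycles {a b : ℕ} (h : a ≤ b) (i : ℕ)
    {z : (Fin i ↪o Fin n) →₀ C} (hz : z ∈ koszulCycles x b i) :
    koszulTransitionMap x a b i z ∈ koszulCycles x a i := by
  cases i with
  | zero =>
    obtain ⟨w, rfl⟩ := hz
    exact ⟨_, koszulD_koszulTransitionMap x h 0 w⟩
  | succ i =>
    rw [koszulCycles, LinearMap.mem_ker] at hz ⊢
    rw [koszulD_koszulTransitionMap x h, hz, map_zero]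

variable {x} in
-- In degree zero the augmented cycles are boundaries by definition, so no transition is needed
-- there.
lemma CyclesToBoundaries.exists_le_range (hx : CyclesToBoundaries x) (a i : ℕ) :
    ∃ b, a ≤ b ∧ ∀ z ∈ koszulCycles x b i,
      koszulTransitionMap x a b i z ∈ LinearMap.range (koszulD (fun k => x k ^ a) i) := by
  cases i with
  | zero => exact ⟨a, le_rfl, fun z hz => koszulTransitionMap_mem_koszulCycles x le_rfl 0 hz⟩
  | succ i =>
    obtain ⟨b, hb, h⟩ := hx a
    exact ⟨b, hb, h i⟩

/-- The transition map on cycles. -/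
def koszulCyclesMap {a b : ℕ} (h : a ≤ b) (i : ℕ) : koszulCycles x b i →ₗ[C] koszulCycles x a i :=
  (koszulTransitionMap x a b i).restrict fun _ hz => koszulTransitionMap_mem_koszulCycles x h i hz

/-- The map induced by the differential from the chains modulo cycles to the cycles. -/
def koszulBoundaryMap (a i : ℕ) :
    (((Fin (i + 1) ↪o Fin n) →₀ C) ⧸ koszulCycles x a (i + 1)) →ₗ[C] koszulCycles x a i :=
  LinearMap.codRestrict (koszulCycles x a i)
    (Submodule.liftQ (koszulCycles x a (i + 1)) (koszulD (fun k => x k ^ a) i) le_rfl) fun z => by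
      obtain ⟨z, rfl⟩ := Submodule.Quotient.mk_surjective _ z
      exact koszulD_mem_koszulCycles x a i z

/-- The exact sequence relating cycles and boundaries in the Koszul complex of `x ^ a`. -/
abbrev koszulCyclesSequence (a i : ℕ) : ShortComplex (ModuleCat.{u} C) where
  X₁ := ModuleCat.of C (koszulCycles x a i)
  X₂ := ModuleCat.of C ((Fin i ↪o Fin n) →₀ C)
  X₃ := ModuleCat.of C (((Fin i ↪o Fin n) →₀ C) ⧸ koszulCycles x a i)
  f := ModuleCat.ofHom (koszulCycles x a i).subtype
  g := ModuleCat.ofHom (koszulCycles x a i).mkQ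
  zero := ModuleCat.hom_ext (LinearMap.ext fun z => (Submodule.Quotient.mk_eq_zero _).2 z.2)

lemma koszulCyclesSequence_shortExact (a i : ℕ) : (koszulCyclesSequence x a i).ShortExact :=
  ModuleCat.shortComplex_shortExact _ (LinearMap.exact_subtype_mkQ (koszulCycles x a i))
    Subtype.val_injective (koszulCycles x a i).mkQ_surjective

/-- The transition map between the exact sequences relating cycles and boundaries. -/
def koszulCyclesSequenceMap {a b : ℕ} (h : a ≤ b) (i : ℕ) :
    koszulCyclesSequence x b i ⟶ koszulCyclesSequence x a i where
  τ₁ := ModuleCat.ofHom (koszulCyclesMap x h i)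
  τ₂ := ModuleCat.ofHom (koszulTransitionMap x a b i)
  τ₃ := ModuleCat.ofHom (Submodule.mapQ _ _ (koszulTransitionMap x a b i)
    fun _ hz => koszulTransitionMap_mem_koszulCycles x h i hz)
  comm₁₂ := rfl
  comm₂₃ := rfl

variable {x}

/-- If the quotients by the powers of `x` have projective dimension at most `r`, every class in
`Ext^j` of the `i`-cycles, `i + j = r`, extends to the Koszul complex after some transition. -/
lemma CyclesToBoundaries.exists_extension (hx : CyclesToBoundaries x) {r : ℕ}
    (hr : ∀ a, HasProjectiveDimensionLE (koszulCyclesSequence x a 0).X₃ r)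
    (Y : ModuleCat.{u} C) (i j : ℕ) (hij : i + j = r) (a : ℕ)
    (e : Ext (koszulCyclesSequence x a i).X₁ Y j) :
    ∃ (b : ℕ) (h : a ≤ b) (e' : Ext (koszulCyclesSequence x b i).X₂ Y j),
      (Ext.mk₀ (koszulCyclesSequence x b i).f).comp e' (zero_add j) =
        (Ext.mk₀ (koszulCyclesSequenceMap x h i).τ₁).comp e (zero_add j) := by
  induction i generalizing j a with
  | zero =>
    obtain rfl : j = r := by lia
    obtain ⟨e', rfl⟩ := Ext.contravariant_sequence_exact₁ (koszulCyclesSequence_shortExact x a 0) Y e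
      (add_comm 1 j) (Ext.eq_zero_of_hasProjectiveDimensionLT _ (j + 1) le_rfl)
    refine ⟨a, le_rfl, (Ext.mk₀ (koszulCyclesSequenceMap x le_rfl 0).τ₂).comp e' (zero_add j), ?_⟩
    rw [Ext.mk₀_comp_mk₀_assoc, Ext.mk₀_comp_mk₀_assoc, ShortComplex.Hom.comm₁₂]
  | succ i ih =>
    obtain ⟨b, hab, hb⟩ := hx.exists_le_range a i
    -- Transitioned cycles are boundaries, so the differential can be inverted on them modulo
    -- cycles.
    let θ : koszulCycles x b i →ₗ[C] (_ ⧸ koszulCycles x a (i + 1)) :=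
      (koszulD (fun k => x k ^ a) i).quotKerEquivRange.symm.toLinearMap ∘ₗ
        LinearMap.codRestrict _ (koszulTransitionMap x a b i ∘ₗ Submodule.subtype _)
          fun z => hb z z.2
    have hθ (z : koszulCycles x b i) (w) (hw : koszulD (fun k => x k ^ a) i w =
        koszulTransitionMap x a b i z) : θ z = Submodule.Quotient.mk w := by
      refine (LinearEquiv.symm_apply_eq _).2 (Subtype.ext ?_)
      exact hw.symm
    let e₁ : Ext (koszulCyclesSequence x b i).X₁ Y (j + 1) :=
      (Ext.mk₀ (ModuleCat.ofHom θ)).comp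
        ((koszulCyclesSequence_shortExact x a (i + 1)).extClass.comp e (add_comm 1 j)) (zero_add _)
    obtain ⟨c, hbc, e₁', he₁⟩ := ih (j + 1) (by lia) b e₁
    have : Projective (koszulCyclesSequence x c i).X₂ :=
      ModuleCat.projective_of_categoryTheory_projective (ModuleCat.of C ((Fin i ↪o Fin n) →₀ C))
    -- The extension lies in a positive `Ext` of a free module, so the pullback of `e₁` to the
    -- cycles at level `c` is zero.
    rw [e₁'.eq_zero_of_projective, Ext.comp_zero] at he₁
    -- Chains modulo cycles map by the differential to cycles one degree lower, and `θ` returns from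
    -- there. The obstruction to extending the transitioned `e` therefore factors through the
    -- vanishing class.
    have hfac : (koszulCyclesSequenceMap x (hab.trans hbc) (i + 1)).τ₃ =
        ModuleCat.ofHom (koszulBoundaryMap x c i) ≫ (koszulCyclesSequenceMap x hbc i).τ₁ ≫ ModuleCat.ofHom θ := by
      refine ModuleCat.hom_ext (LinearMap.ext fun z => ?_)
      obtain ⟨z, rfl⟩ := Submodule.Quotient.mk_surjective _ z
      refine (hθ _ (koszulTransitionMap x a c (i + 1) z) ?_).symm
      rw [koszulD_koszulTransitionMap x (hab.trans hbc), ← koszulTransitionMap_trans x hab hbc]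
      rfl
    obtain ⟨e', he'⟩ := Ext.contravariant_sequence_exact₁
      (koszulCyclesSequence_shortExact x c (i + 1)) Y
      ((Ext.mk₀ (koszulCyclesSequenceMap x (hab.trans hbc) (i + 1)).τ₁).comp e (zero_add j))
      (add_comm 1 j) (by
        rw [← Ext.comp_assoc _ _ _ (add_zero 1) (zero_add j) (by lia),
          ShortComplex.ShortExact.extClass_naturality _
            (koszulCyclesSequence_shortExact x a (i + 1)),
          Ext.comp_assoc _ _ _ (zero_add 1) (add_comm 1 j) (by lia), hfac,
          ← Ext.mk₀_comp_mk₀_assoc, ← Ext.mk₀_comp_mk₀_assoc]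
        change (Ext.mk₀ _).comp ((Ext.mk₀ _).comp e₁ _) _ = 0
        rw [← he₁, Ext.comp_zero])
    exact ⟨c, hab.trans hbc, e', he'⟩

end Koszul

/-- If the quotients by the powers of a weakly proregular sequence `x` of length `r + 1` have
projective dimension at most `r`, its top Čech cohomology vanishes. -/
theorem CyclesToBoundaries.exists_prod_pow_mem {C : Type u} [CommRing C] {r : ℕ}
    {x : Fin (r + 1) → C} (hx : CyclesToBoundaries x)
    (hr : ∀ a, HasProjectiveDimensionLE (koszulCyclesSequence x a 0).X₃ r) (a₀ : ℕ) :
    ∃ b, a₀ ≤ b ∧ (∏ k, x k) ^ (b - a₀) ∈ Ideal.span (Set.range fun k => x k ^ b) := by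
  obtain ⟨a, ha, hker⟩ := hx a₀
  obtain ⟨b, hab, hb⟩ := hx.exists_le_range a r
  -- There are no chains in degree `r + 2`, so the transition to `a₀` sends top cycles to zero. This
  -- is why a second level `a` sits between `a₀` and `b`: on it `ψ` lifts along the differential
  -- with values in actual chains.
  have hker' : LinearMap.ker (koszulD (fun k => x k ^ a) r) ≤
      LinearMap.ker (koszulTransitionMap x a₀ a (r + 1)) := by
    intro z hz
    obtain ⟨w, hw⟩ := hker r z hz
    have : IsEmpty (Fin (r + 2) ↪o Fin (r + 1)) :=
      ⟨fun σ => by simpa using Fintype.card_le_of_embedding σ.toEmbedding⟩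
    rw [LinearMap.mem_ker, ← hw, Subsingleton.elim w 0, map_zero]
  let ψ : koszulCycles x b r →ₗ[C] ((Fin (r + 1) ↪o Fin (r + 1)) →₀ C) :=
    Submodule.liftQ _ (koszulTransitionMap x a₀ a (r + 1)) hker' ∘ₗ
      (koszulD (fun k => x k ^ a) r).quotKerEquivRange.symm.toLinearMap ∘ₗ
        LinearMap.codRestrict _ (koszulTransitionMap x a b r ∘ₗ Submodule.subtype _)
          fun z => hb z z.2
  have hψ (z : koszulCycles x b r) (w) (hw : koszulD (fun k => x k ^ a) r w =
      koszulTransitionMap x a b r z) : ψ z = koszulTransitionMap x a₀ a (r + 1) w := by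
    have : (koszulD (fun k => x k ^ a) r).quotKerEquivRange.symm
        (LinearMap.codRestrict _ (koszulTransitionMap x a b r ∘ₗ Submodule.subtype _)
          (fun z => hb z z.2) z) = Submodule.Quotient.mk w :=
      (LinearEquiv.symm_apply_eq _).2 (Subtype.ext hw.symm)
    change Submodule.liftQ _ _ hker' (LinearEquiv.symm _ _) = _
    rw [this]
    rfl
  obtain ⟨c, hbc, e', he'⟩ := hx.exists_extension hr (ModuleCat.of C _) r 0 rfl b
    (Ext.mk₀ (ModuleCat.ofHom ψ))
  obtain ⟨g, rfl⟩ := (Ext.mk₀_bijective _ _).2 e'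
  rw [Ext.mk₀_comp_mk₀, Ext.mk₀_comp_mk₀, (Ext.mk₀_bijective _ _).1.eq_iff] at he'
  -- Evaluating at the boundary of the top generator, `ψ` gives `∏ x_k ^ (c - a₀)`, while `g` gives
  -- a combination of the coefficients `± x_k ^ c` of that boundary.
  let τ : Fin (r + 1) ↪o Fin (r + 1) := RelEmbedding.refl _
  have key := LinearMap.congr_fun (congrArg ModuleCat.Hom.hom he')
    (⟨_, koszulD_mem_koszulCycles x c r (Finsupp.single τ 1)⟩ : koszulCycles x c r)
  change g.hom (koszulD (fun k => x k ^ c) r (Finsupp.single τ 1)) =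
    ψ (koszulCyclesMap x hbc r _) at key
  rw [hψ _ (koszulTransitionMap x a c (r + 1) (Finsupp.single τ 1)) (by
    rw [koszulD_koszulTransitionMap x (hab.trans hbc), ← koszulTransitionMap_trans x hab hbc]; rfl),
    koszulTransitionMap_trans x ha (hab.trans hbc), koszulTransitionMap_single] at key
  refine ⟨c, ha.trans (hab.trans hbc), ?_⟩
  have := DFunLike.congr_fun key τ
  rw [Finsupp.single_eq_same, one_mul] at this
  rw [← Finset.prod_pow]
  refine this ▸ ?_
  rw [koszulD, Finsupp.linearCombination_single, one_smul, map_sum, Finsupp.finsetSum_apply]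
  refine Ideal.sum_mem _ fun j _ => ?_
  rw [← mul_one ((-1) ^ (j : ℕ) * _), ← smul_eq_mul, ← Finsupp.smul_single, map_smul,
    Finsupp.smul_apply, smul_eq_mul]
  exact Ideal.mul_mem_right _ _ (Ideal.mul_mem_left _ _ (Ideal.subset_span ⟨_, rfl⟩))

/-- The cokernel of the last differential of the Koszul complex is the quotient ring. -/
def koszulQuotientEquiv {C : Type u} [CommRing C] {n : ℕ} (x : Fin n → C) (a : ℕ) :
    (_ ⧸ koszulCycles x a 0) ≃ₗ[C] C ⧸ Ideal.span (Set.range fun k => x k ^ a) :=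
  have : Subsingleton (Fin 0 ↪o Fin n) := ⟨fun _ _ => by ext k; exact k.elim0⟩
  Submodule.Quotient.equiv _ _ (Finsupp.uniqueLinearEquiv C C OrderEmbedding.ofIsEmpty) <| by
    rw [koszulCycles, koszulD, Finsupp.range_linearCombination]
    erw [Submodule.map_span]
    rw [← Set.range_comp]
    congr 1
    ext r
    constructor
    · rintro ⟨σ, rfl⟩
      refine ⟨σ 0, ?_⟩
      simp [Finsupp.single_apply, eq_iff_true_of_subsingleton]
    · rintro ⟨k, rfl⟩
      refine ⟨OrderEmbedding.ofStrictMono (fun _ => k) (Subsingleton.strictMono (α := Fin 1) _), ?_⟩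
      simp [Finsupp.single_apply, eq_iff_true_of_subsingleton]

end

end NonNoetherianCM

namespace NonNoetherianCM

noncomputable section

/-! ### Weak proregularity in terms of elements -/

/-- A chain map of complexes of modules which is zero on homology maps cycles to boundaries. -/
lemma exists_d_eq_of_homologyMap_eq_zero {R : Type u} [CommRing R]
    {K L : ChainComplex (ModuleCat.{u} R) ℕ} (φ : K ⟶ L) (i : ℕ)
    (h : HomologicalComplex.homologyMap φ (i + 1) = 0) (z : K.X (i + 1))
    (hz : K.d (i + 1) i z = 0) : ∃ w, L.d (i + 2) (i + 1) w = φ.f (i + 1) z := by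
  -- The cycle is encoded as a morphism from `R`. Vanishing in homology makes its image a boundary
  -- after an epimorphism onto `R`, and a preimage of `1` supplies the chain.
  let k : ModuleCat.of R R ⟶ K.X (i + 1) := ModuleCat.ofHom (LinearMap.toSpanSingleton R _ z)
  have hk : k ≫ K.d (i + 1) i = 0 :=
    ModuleCat.hom_ext (LinearMap.ext_ring (by simpa [k] using hz))
  have hnext : (ComplexShape.down ℕ).next (i + 1) = i := by simp
  have h1 := congrArg (fun f => K.liftCycles k i hnext hk ≫ K.homologyπ (i + 1) ≫ f) h
  simp only [HomologicalComplex.homologyπ_naturality, Limits.comp_zero,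
    HomologicalComplex.liftCycles_comp_cyclesMap_assoc] at h1
  rw [HomologicalComplex.liftCycles_comp_homologyπ_eq_zero_iff_up_to_refinements _ (i + 2) (i + 1) i
    (by simp) hnext] at h1
  obtain ⟨A', π, hπ, w, hw⟩ := h1
  obtain ⟨p, hp⟩ := (ModuleCat.epi_iff_surjective π).1 hπ (1 : R)
  refine ⟨w p, ?_⟩
  have h2 := LinearMap.congr_fun (congrArg ModuleCat.Hom.hom hw) p
  simpa [k, hp] using h2.symm

lemma IsWeaklyProregular.cyclesToBoundaries {R : Type u} [CommRing R] {n : ℕ} {x : Fin n → R}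
    (hx : IsWeaklyProregular x) : CyclesToBoundaries x := by
  intro a
  obtain ⟨b, hab, hb⟩ := hx a
  have hd (c j : ℕ) : (koszulComplex fun k => x k ^ c).d (j + 1) j =
      ModuleCat.ofHom (koszulD (fun k => x k ^ c) j) := by
    simp only [koszulComplex, ChainComplex.of_d]
  refine ⟨b, hab, fun i z hz => ?_⟩
  obtain ⟨w, hw⟩ := exists_d_eq_of_homologyMap_eq_zero (koszulTransition x hab) i
    (hb (i + 1) (by lia)) z (by rw [hd]; exact hz)
  rw [hd] at hw
  exact ⟨w, hw⟩

/-! ### Localization of Koszul complexes -/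

section Localization

variable {A : Type u} [CommRing A] (S : Submonoid A) (C : Type u) [CommRing C] [Algebra A C]

lemma koszulD_mapRange {n : ℕ} (x : Fin n → A) (i : ℕ) (z : (Fin (i + 1) ↪o Fin n) →₀ A) :
    koszulD (fun k => algebraMap A C (x k)) i (Finsupp.mapRange.linearMap (Algebra.linearMap A C) z) =
      Finsupp.mapRange.linearMap (Algebra.linearMap A C) (koszulD x i z) := by
  induction z using Finsupp.induction_linear with
  | zero => simp
  | add f g hf hg => simp only [map_add, hf, hg]
  | single σ r =>
    simp [koszulD, Finset.smul_sum, Algebra.smul_def, -Finsupp.single_mul]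

lemma koszulTransitionMap_mapRange {n : ℕ} (x : Fin n → A) (a b i : ℕ)
    (z : (Fin i ↪o Fin n) →₀ A) :
    koszulTransitionMap (fun k => algebraMap A C (x k)) a b i
        (Finsupp.mapRange.linearMap (Algebra.linearMap A C) z) =
      Finsupp.mapRange.linearMap (Algebra.linearMap A C) (koszulTransitionMap x a b i z) := by
  induction z using Finsupp.induction_linear with
  | zero => simp
  | add f g hf hg => simp only [map_add, hf, hg]
  | single σ r => simp [koszulTransitionMap_single, -Finsupp.single_mul]

variable {C} in
-- Denominators are cleared twice, by `s` to lift the cycle and by `t` to make the lift a cycle.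
-- Both become units, so the same `b` works.
lemma CyclesToBoundaries.of_isLocalization [IsLocalization S C] {n : ℕ} {x : Fin n → A}
    (hx : CyclesToBoundaries x) : CyclesToBoundaries fun k => algebraMap A C (x k) := by
  intro a
  obtain ⟨b, hab, hb⟩ := hx a
  refine ⟨b, hab, fun i z hz => ?_⟩
  obtain ⟨⟨w, s⟩, hw⟩ := IsLocalizedModule.surj S
    (Finsupp.mapRange.linearMap (α := Fin (i + 1) ↪o Fin n) (Algebra.linearMap A C)) z
  have hw : algebraMap A C s • z = Finsupp.mapRange.linearMap (Algebra.linearMap A C) w := by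
    rw [← hw, algebraMap_smul]; rfl
  simp only [← map_pow] at hz ⊢
  have h1 : Finsupp.mapRange.linearMap (Algebra.linearMap A C)
      (koszulD (fun k => x k ^ b) i w) = 0 := by
    rw [← koszulD_mapRange, ← hw, map_smul, hz, smul_zero]
  obtain ⟨t, ht⟩ := (IsLocalizedModule.eq_zero_iff S
    (Finsupp.mapRange.linearMap (α := Fin i ↪o Fin n) (Algebra.linearMap A C))).1 h1
  obtain ⟨v, hv⟩ := hb i ((t : A) • w) (by rw [map_smul]; exact ht)
  have hu : IsUnit (algebraMap A C t * algebraMap A C s) :=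
    (IsLocalization.map_units C t).mul (IsLocalization.map_units C s)
  refine (Submodule.smul_mem_iff_of_isUnit _ hu).1
    ⟨Finsupp.mapRange.linearMap (Algebra.linearMap A C) v, ?_⟩
  rw [koszulD_mapRange, hv, ← koszulTransitionMap_mapRange, ← map_smul, map_smul, mul_smul, hw,
    algebraMap_smul]

end Localization

/-! ### Vanishing of the top Čech cohomology -/

section Cech

variable {A : Type u} [CommRing A] {r : ℕ}

lemma cechD_single (x : Fin (r + 1) → A) (j : Fin (r + 1))
    (τ : Fin (r + 1) ↪o Fin (r + 1)) (u : Localization.Away (tupleProd x (face τ j))) :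
    cechD x r (Pi.single (face τ j) u) τ =
      (-1 : A) ^ (j : ℕ) • awayRestrict (tupleProd_face_dvd x τ j) u := by
  rw [cechD, LinearMap.pi_apply, LinearMap.sum_apply, Finset.sum_eq_single j]
  · simp
  · intro i _ hij
    have : face τ i ≠ face τ j := by
      intro h
      refine hij (Fin.succAbove_left_injective (funext fun k => τ.injective ?_))
      exact DFunLike.congr_fun h k
    simp [Pi.single_eq_of_ne this]
  · simp

/-- With `P = ∏ x_k` and `s P^(b-a) = ∑ g_j x_j^b`, a top cochain `c / P^a` satisfies `s c / P^a = ∑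
c g_j / (P / x_j)^b`, where `P / x_j` denotes the product omitting `x_j`. Each summand comes from
the localization at a face. -/
lemma exists_smul_mem_range_cechD {S : Submonoid A} {x : Fin (r + 1) → A}
    (h : ∀ a, ∃ b, a ≤ b ∧ ∃ s ∈ S, s * (∏ k, x k) ^ (b - a) ∈ Ideal.span (Set.range fun k => x k ^ b))
    (f : CechModule x (r + 1)) : ∃ s ∈ S, s • f ∈ LinearMap.range (cechD x r) := by
  let τ : Fin (r + 1) ↪o Fin (r + 1) := RelEmbedding.refl _
  have hP : tupleProd x τ = ∏ k, x k := rfl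
  obtain ⟨a, c, hc⟩ := IsLocalization.Away.surj (tupleProd x τ) (f τ)
  obtain ⟨b, hab, s, hs, hmem⟩ := h a
  refine ⟨s, hs, ?_⟩
  obtain ⟨g, hg⟩ := (Submodule.mem_span_range_iff_exists_fun A).1 hmem
  have hu (j : Fin (r + 1)) : ∃ u : Localization.Away (tupleProd x (face τ j)),
      u * algebraMap A _ (tupleProd x (face τ j) ^ b) = algebraMap A _ (c * g j) :=
    ⟨IsLocalization.mk' _ (c * g j) (⟨_, b, rfl⟩ : Submonoid.powers (tupleProd x (face τ j))),
      IsLocalization.mk'_spec _ _ _⟩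
  choose u hu using hu
  -- The signs cancel those of the Čech differential.
  refine ⟨∑ j, Pi.single (face τ j) ((-1 : A) ^ (j : ℕ) • u j), ?_⟩
  funext σ
  obtain rfl : τ = σ := by
    have hsurj (ρ : Fin (r + 1) ↪o Fin (r + 1)) : Set.range ρ = Set.univ :=
      (Finite.injective_iff_surjective.1 ρ.injective).range_eq
    exact OrderEmbedding.range_inj.1 (by rw [hsurj, hsurj])
  have hunit := (IsLocalization.Away.algebraMap_isUnit (S := Localization.Away (tupleProd x τ))
    (tupleProd x τ)).pow b
  rw [← hunit.mul_left_inj, map_sum, Finset.sum_apply, Finset.sum_mul]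
  have hterm (j : Fin (r + 1)) : cechD x r (Pi.single (face τ j) ((-1 : A) ^ (j : ℕ) • u j)) τ *
      algebraMap A _ (tupleProd x τ) ^ b = algebraMap A _ (c * (g j * x j ^ b)) := by
    have h1 : tupleProd x τ = x j * tupleProd x (face τ j) := by
      rw [tupleProd, tupleProd, Fin.prod_univ_succAbove _ j]; rfl
    have h2 := congrArg (awayRestrict (tupleProd_face_dvd x τ j)) (hu j)
    rw [map_mul, AlgHom.commutes, AlgHom.commutes] at h2
    rw [cechD_single, map_smul, smul_smul, ← mul_pow, neg_one_mul, neg_neg, one_pow, one_smul]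
    have h3 : tupleProd x τ ^ b = tupleProd x (face τ j) ^ b * x j ^ b := by rw [h1]; ring
    rw [← map_pow, h3, map_mul, ← mul_assoc, h2, ← map_mul, mul_assoc]
  simp only [hterm]
  simp only [smul_eq_mul] at hg
  rw [← map_sum, ← Finset.mul_sum, hg, Pi.smul_apply, Algebra.smul_def, map_mul, ← hc, map_mul,
    map_pow, ← hP, ← Nat.add_sub_cancel' hab, pow_add, Nat.add_sub_cancel_left]
  ring

/-- If every cochain has a multiple by an element of `S` which is a coboundary, then the
localization at `S` of the cohomology vanishes. -/
lemma subsingleton_localizedModule_homology (S : Submonoid A)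
    (K : CochainComplex (ModuleCat.{u} A) ℕ) (i : ℕ)
    (h : ∀ f : K.X (i + 1), ∃ s ∈ S, ∃ w, K.d i (i + 1) w = s • f) :
    Subsingleton (LocalizedModule S (K.homology (i + 1))) := by
  rw [LocalizedModule.subsingleton_iff]
  intro m
  obtain ⟨z, rfl⟩ := (ModuleCat.epi_iff_surjective (K.homologyπ (i + 1))).1 inferInstance m
  obtain ⟨s, hs, w, hw⟩ := h (K.iCycles (i + 1) z)
  refine ⟨s, hs, ?_⟩
  have hz : s • z = K.toCycles i (i + 1) w := by
    apply (ModuleCat.mono_iff_injective (K.iCycles (i + 1))).1 inferInstance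
    rw [map_smul, ← hw, ← ConcreteCategory.comp_apply, HomologicalComplex.toCycles_i]
  rw [← map_smul, hz, ← ConcreteCategory.comp_apply, HomologicalComplex.toCycles_comp_homologyπ]
  rfl

lemma subsingleton_localizedModule_cechCohomology {S : Submonoid A} {x : Fin (r + 1) → A}
    (h : ∀ a, ∃ b, a ≤ b ∧ ∃ s ∈ S,
      s * (∏ k, x k) ^ (b - a) ∈ Ideal.span (Set.range fun k => x k ^ b)) :
    Subsingleton (LocalizedModule S (cechCohomology x (r + 1))) := by
  refine subsingleton_localizedModule_homology S (cechComplex x) r fun f => ?_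
  have hd : (cechComplex x).d r (r + 1) = ModuleCat.ofHom (cechD x r) := by
    simp only [cechComplex, CochainComplex.of_d]
  obtain ⟨s, hs, w, hw⟩ := exists_smul_mem_range_cechD h f
  exact ⟨s, hs, w, by rw [hd]; exact hw⟩

end Cech
end
end NonNoetherianCM

namespace NonNoetherianCM

open RingTheory.Sequence IsLocalRing

/-! ### Localizing at a zero divisor -/

/-- Some power of the finitely generated `J` lies in `(I : b)`. If `k + 1` is the least such
exponent, any `c ∈ J^k` outside `(I : b)` gives the witness `c * b`. The exponent is positive
because `b ∉ I`. -/
lemma depthZero_of_le_radical {C : Type*} [CommRing C] [IsLocalRing C] {I : Ideal C} {b : C}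
    (hb : b ∉ I)
    (h : maximalIdeal C ≤ (Submodule.colon I {b}).radical) :
    DepthZero I := by
  classical
  intro J hJ hJm
  set N : Ideal C := Submodule.colon I {b}
  have hN (a : C) : a ∈ N ↔ a * b ∈ I := Submodule.mem_colon_singleton
  have hex := Ideal.exists_pow_le_of_le_radical_of_fg (hJm.trans h) hJ
  obtain ⟨k, hk⟩ : ∃ k, Nat.find hex = k + 1 := Nat.exists_eq_succ_of_ne_zero fun h0 => by
    have h1 := Nat.find_spec hex
    rw [h0, pow_zero, Ideal.one_eq_top] at h1
    exact hb (by simpa [hN] using h1 (Submodule.mem_top (x := (1 : C))))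
  obtain ⟨c, hcJ, hcN⟩ := SetLike.not_le_iff_exists.1 (Nat.find_min hex (m := k) (by lia))
  refine ⟨c * b, fun h => hcN ((hN c).2 h), fun a ha => ?_⟩
  have h1 := Nat.find_spec hex
  rw [hk, pow_succ] at h1
  have h2 := (hN _).1 (h1 (Ideal.mul_mem_mul hcJ ha))
  rwa [mul_right_comm] at h2

/-- A prime of the localization containing `(IC : b)` contracts to a prime between `(I : b)` and
`q`, hence to `q` by minimality. So the maximal ideal lies in the radical of `(IC : b)`. -/
lemma depthZero_map_localization {A : Type u} [CommRing A] {I : Ideal A} {b : A} {q : Ideal A}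
    [q.IsPrime]
    (hq : q ∈ (Submodule.colon I {b}).minimalPrimes) :
    DepthZero (I.map (algebraMap A (Localization.AtPrime q))) := by
  set C := Localization.AtPrime q
  refine depthZero_of_le_radical (b := algebraMap A C b) ?_ ?_
  · rw [IsLocalization.algebraMap_mem_map_algebraMap_iff q.primeCompl]
    rintro ⟨u, hu, hub⟩
    exact hu (hq.1.2 (Submodule.mem_colon_singleton.2 hub))
  · rw [Ideal.radical_eq_sInf]
    refine le_sInf fun P hP => ?_
    have hPp := hP.2
    have hle : P.under A ≤ q := by
      refine le_of_le_of_eq ?_ (IsLocalization.AtPrime.under_maximalIdeal C q)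
      exact Ideal.comap_mono (IsLocalRing.le_maximalIdeal hPp.ne_top)
    have h1 : q ≤ P.under A := hq.2 ⟨inferInstance, fun a ha => hP.1 (by
      rw [Submodule.mem_colon_singleton, smul_eq_mul, ← map_mul]
      exact Ideal.mem_map_of_mem _ (Submodule.mem_colon_singleton.1 ha))⟩ hle
    rw [← Localization.AtPrime.map_eq_maximalIdeal]
    exact Ideal.map_le_iff_le_comap.2 h1

lemma ofList_ofFn {A : Type*} [CommRing A] {n : ℕ} (x : Fin n → A) :
    Ideal.ofList (List.ofFn x) = Ideal.span (Set.range x) := by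
  rw [Ideal.ofList]
  congr 1
  ext a
  simp [List.mem_ofFn]

/-- Let `x₁, …, x_{r+1}` be a parameter sequence such that `x₁, …, x_r` is weakly regular. If the
quotients by powers of `x` have finite free resolutions locally, then `x_{r+1}` is a
non-zero-divisor modulo `x₁, …, x_r`. -/
theorem IsParameterSequence.isSMulRegular_last {A : Type u} [CommRing A] {r : ℕ}
    {x : Fin (r + 1) → A} (hx : IsParameterSequence x)
    (hreg : IsWeaklyRegular A (List.ofFn fun k : Fin r => x k.castSucc))
    (hfree : ∀ (q : Ideal A) (_ : q.IsPrime) (a : ℕ),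
      HasFiniteFreeResolution (Localization.AtPrime q) (Localization.AtPrime q ⧸
        Ideal.span (Set.range fun k => algebraMap A (Localization.AtPrime q) (x k) ^ a))) :
    IsSMulRegular (A ⧸ (Ideal.ofList (List.ofFn fun k : Fin r => x k.castSucc) • ⊤ : Submodule A A))
      (x (Fin.last r)) := by
  set I : Ideal A := Ideal.ofList (List.ofFn fun k : Fin r => x k.castSucc) with hI
  rw [smul_eq_mul, Ideal.mul_top, isSMulRegular_quotient_iff_mem_of_smul_mem]
  intro b hxb
  by_contra hb
  set N : Ideal A := Submodule.colon I {b}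
  have hN (a : A) : a ∈ N ↔ a * b ∈ I := Submodule.mem_colon_singleton
  have hNtop : N ≠ ⊤ := fun h => hb (by
    simpa [hN] using (h ▸ Submodule.mem_top : (1 : A) ∈ N))
  obtain ⟨q, hq⟩ := Ideal.nonempty_minimalPrimes hNtop
  have hqp : q.IsPrime := hq.1.1
  have hxq : Ideal.span (Set.range x) ≤ q := by
    rw [Ideal.span_le]
    rintro _ ⟨k, rfl⟩
    refine hq.1.2 ((hN _).2 ?_)
    induction k using Fin.lastCases with
    | last => exact hxb
    | cast k =>
      refine Ideal.mul_mem_right _ _ ?_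
      rw [hI, ofList_ofFn]
      exact Ideal.subset_span ⟨k, rfl⟩
  -- Nonvanishing of the top Čech cohomology at `q` is contradicted by bounding projective
  -- dimensions over the localization at `q`.
  refine not_subsingleton_iff_nontrivial.2 (hx.nontrivial_localization q hqp hxq)
    (subsingleton_localizedModule_cechCohomology fun a => ?_)
  let C := Localization.AtPrime q
  have hd : DepthZero (Ideal.ofList ((List.ofFn fun k : Fin r => x k.castSucc).map
      (algebraMap A C))) := by
    rw [← Ideal.map_ofList]
    exact depthZero_map_localization hq
  have hregC : IsWeaklyRegular C ((List.ofFn fun k : Fin r => x k.castSucc).map (algebraMap A C)) :=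
    hreg.of_flat
  have hpd (a : ℕ) : HasProjectiveDimensionLE
      (koszulCyclesSequence (fun k => algebraMap A C (x k)) a 0).X₃ r := by
    have := ((hfree q hqp a).of_equiv (koszulQuotientEquiv _ a).symm).hasProjectiveDimensionLE
      hd hregC
    simpa using this
  obtain ⟨b, hab, hmem⟩ :=
    (hx.weaklyProregular.cyclesToBoundaries.of_isLocalization q.primeCompl
      (C := C)).exists_prod_pow_mem hpd a
  refine ⟨b, hab, (IsLocalization.algebraMap_mem_map_algebraMap_iff q.primeCompl C _ _).1 ?_⟩
  rw [Ideal.map_span, ← Set.range_comp]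
  simpa [Function.comp_def] using hmem

/-- Clearing denominators of the generators shows that the ideal is extended from a finitely
generated ideal of `R`; flat base change does the rest. -/
lemma hasFiniteFreeResolution_quotient_of_isLocalization {R A : Type u} [CommRing R] [CommRing A]
    [Algebra R A] (S : Submonoid R) [IsLocalization S A]
    (h : ∀ I : Ideal R, I.FG → HasFiniteFreeResolution R (R ⧸ I)) {n : ℕ} (x : Fin n → A) :
    HasFiniteFreeResolution A (A ⧸ Ideal.span (Set.range x)) := by
  have := IsLocalization.flat A S
  choose y hy using fun k => IsLocalization.surj S (x k)
  have : Ideal.span (Set.range x) =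
      (Ideal.span (Set.range fun k => (y k).1)).map (algebraMap R A) := by
    rw [Ideal.map_span, ← Set.range_comp]
    refine le_antisymm (Ideal.span_le.2 ?_) (Ideal.span_le.2 ?_)
    · rintro _ ⟨k, rfl⟩
      refine (Ideal.mul_unit_mem_iff_mem _ (IsLocalization.map_units A (y k).2)).1 ?_
      rw [hy]
      exact Ideal.subset_span ⟨k, rfl⟩
    · rintro _ ⟨k, rfl⟩
      rw [Function.comp_apply, ← hy]
      exact Ideal.mul_mem_right _ _ (Ideal.subset_span ⟨k, rfl⟩)
  rw [this]
  exact hasFiniteFreeResolution_quotient_map A (h _ (Submodule.fg_span (Set.finite_range _)))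

/-- A strong parameter sequence is weakly regular if the quotients by powers of elements have finite
free resolutions locally. -/
lemma IsStrongParameterSequence.isWeaklyRegular {A : Type u} [CommRing A] {n : ℕ} {x : Fin n → A}
    (hx : IsStrongParameterSequence x)
    (hfree : ∀ (i : ℕ) (y : Fin i → A), HasFiniteFreeResolution A (A ⧸ Ideal.span (Set.range y)))
    (i : ℕ) (hi : i ≤ n) : IsWeaklyRegular A (List.ofFn fun k : Fin i => x (Fin.castLE hi k)) := by
  induction i with
  | zero => simp
  | succ i ih =>
    have hreg := ih (by lia)
    rw [List.ofFn_succ', List.concat_eq_append, isWeaklyRegular_append_iff,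
      isWeaklyRegular_singleton_iff]
    refine ⟨hreg, (hx (i + 1) (by lia) hi).isSMulRegular_last hreg fun q _ a => ?_⟩
    have h := hasFiniteFreeResolution_quotient_map (Localization.AtPrime q)
      (hfree (i + 1) fun k => x (Fin.castLE hi k) ^ a)
    rw [Ideal.map_span, ← Set.range_comp] at h
    have e : (fun k => algebraMap A (Localization.AtPrime q) (x (Fin.castLE hi k)) ^ a) =
        algebraMap A (Localization.AtPrime q) ∘ fun k => x (Fin.castLE hi k) ^ a :=
      funext fun k => (map_pow _ _ _).symm
    rw [e]
    exact h

end NonNoetherianCM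

theorem theorem4p8 (R : Type u) [CommRing R] (hcoh : NonNoetherianCM.IsCoherent R)
    (hreg : NonNoetherianCM.IsRegular R) : NonNoetherianCM.IsLocallyCohenMacaulay R := by
  intro p hp n x hx
  have hw := hx.isWeaklyRegular (fun i y =>
    NonNoetherianCM.hasFiniteFreeResolution_quotient_of_isLocalization p.primeCompl
      (fun I hI => hreg.hasFiniteFreeResolution_quotient hcoh hI) y) n le_rfl
  refine ⟨hw, ?_⟩
  rw [smul_eq_mul, Ideal.mul_top, NonNoetherianCM.ofList_ofFn]
  -- Strong parameter sequences impose nothing on the empty segment, so for `n = 0` properness comes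
  -- from the local ring being nontrivial.
  rcases Nat.eq_zero_or_pos n with rfl | hn
  · simp
  · exact (hx n hn le_rfl).span_ne_top.symm
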